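/- **Setting.** $N$ users share a slotted collision channel: in each slot $t=0,1,2,\dots$ a transmission succeeds if and only if exactly one user transmits. User $j$ has a binary sequence $s_j$ of period $L$ and an offset $\tau_j\in\mathbb Z_L$. Its local time at slot $t$ is $t+\tau_j$, and it transmits at slot $t$ if and only if $s_j(t+\tau_j)=1$. Local time is divided into frames of length $T$, with $1\le T<L$. At the start of each frame the user generates a packet, which is sent at all transmissions of that frame and then discarded. The instantaneous age of information (AoI) $A_{\boldsymbol\tau}(t)$ of a fixed user $i$ drops, at the first successful transmission of a packet, to the time elapsed since the generation of that packet; otherwise it increases by $1$ per slot, from an arbitrary initial value. Let $\overline{A_{\boldsymbol\tau}}=\lim_{\lambda\to\infty}\frac1\lambda\sum_{t=0}^{\lambda}A_{\boldsymbol\tau}(t)$, and let $\overline A=L^{-N}\sum_{\boldsymbol\tau\in\mathbb Z_L^N}\overline{A_{\boldsymbol\tau}}$. Assume that $s_1,\dots,s_N$ is a minimum Hamming user-irrepressible (MHUI) set in which all sequences have the same Hamming weight $w$: that is, $w\ge N$ and $\sum_{t=0}^{L-1}s_a(t)\,s_b(t+d)\le 1$ for all $a\ne b$ and all $d\in\mathbb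 Z_L$. **Notation.** Let $\beta=\operatorname{lcm}(T,L)$ and $w'=w\beta/L$. Let $y_0<\dots<y_{w'-1}$ be the positions in $[0,\beta)$ of the ones of the periodic sequence $s_i$, and put $\sigma_k=y_k \bmod T$. Put $\ell_k=y_{k+1}-y_k$ for $k<w'-1$ and $\ell_{w'-1}=y_0+\beta-y_{w'-1}$. For $m\in\{w,w'\}$ let $\zeta_m(k,j)=\sum_{u=0}^{j-1}\ell_{(k+u)\bmod m}$. Put $$F_2(\zeta_{w'}(k,j))=\frac{\zeta_{w'}(k,j)\,\sigma_k}{\beta},\qquad F_3(\zeta_w(k,j))=\frac{\zeta_w(k,j)^2}{2L},$$ $$P_r=\frac{1}{L^{N-1}}\sum_{n=w-r}^{N-1}\sum_{m=0}^{w-r}(-1)^m\binom{N-1}{n}\binom{w-r}{m}(w-r-m)^n\,w^n\,(L-w^2)^{N-1-n}\qquad(0^0=1).$$ **Theorem.** Assume that each frame of user $i$ contains at most one "1" (each block $s_i(aT),\dots,s_i(aT+T-1)$, $a\ge 0$, of the periodic sequence $s_i$ contains at most one "1"). Then, for every $\boldsymbol\tau$, the limit $\overline{A_{\boldsymbol\tau}}$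 exists and does not depend on the initial age, and $$\overline A=P_1\Big(\sum_{k=0}^{w'-1}F_2(\zeta_{w'}(k,w))+wF_3(L)\Big)+\sum_{r=2}^{w}P_r\sum_{j=1}^{w-r+1}\frac{(w-j-1)!\,\Big(\sum_{k=0}^{w'-1}F_2(\zeta_{w'}(k,j))+\sum_{k=0}^{w-1}F_3(\zeta_w(k,j))\Big)}{(r-2)!\,(w-j-(r-1))!}-\frac12 .$$ -/

import Mathlib

open Finset Filter Topology

/-- Hamming weight of the word `x 0, …, x (L - 1)`: its number of ones. -/
def hammingWt (L : ℕ) (x : ℕ → Bool) : ℕ :=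
  ((range L).filter (fun t => x t = true)).card

/-- Hamming cross-correlation of two binary sequences of period `L` at relative offset `d`. -/
def crossCorr (L : ℕ) (x y : ℕ → Bool) (d : ℕ) : ℕ :=
  ∑ t ∈ range L, (x t).toNat * (y (t + d)).toNat

/-- A minimum Hamming user-irrepressible (MHUI) set of `N` binary sequences with common period
`L`. A sequence of period `L` is given by its `L`-periodic extension `ℕ → Bool`. -/
structure IsMHUI (N L : ℕ) (s : Fin N → ℕ → Bool) : Prop where
  periodic : ∀ j, Function.Periodic (s j) L
  le_weight : ∀ j, N ≤ hammingWt L (s j)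
  crossCorr_le : ∀ i j, i ≠ j → ∀ d < L, crossCorr L (s i) (s j) d ≤ 1

/-- Every frame (block `m * T, …, m * T + T - 1` of local time) contains at most one `1`. -/
def AtMostOneOnePerFrame (T : ℕ) (x : ℕ → Bool) : Prop :=
  ∀ m : ℕ, ((range T).filter (fun a => x (m * T + a) = true)).card ≤ 1

section System

variable {N L : ℕ}

/-- The local clock of user `j` at system slot `t`, for the offset vector `τ`. -/
def localTime (τ : Fin N → Fin L) (j : Fin N) (t : ℕ) : ℕ := t + (τ j : ℕ)

/-- User `j` transmits in system slot `t`. -/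
def Transmits (s : Fin N → ℕ → Bool) (τ : Fin N → Fin L) (j : Fin N) (t : ℕ) : Prop :=
  s j (localTime τ j t) = true

/-- Collision channel: user `i` transmits in slot `t` and nobody else does. -/
def Succeeds (s : Fin N → ℕ → Bool) (τ : Fin N → Fin L) (i : Fin N) (t : ℕ) : Prop :=
  Transmits s τ i t ∧ ∀ j, j ≠ i → ¬ Transmits s τ j t

/-- Time elapsed in slot `t` since the beginning of the current frame of user `i`, that is, since
the generation of the packet that user `i` currently holds. -/
def packetAge (T : ℕ) (τ : Fin N → Fin L) (i : Fin N) (t : ℕ) : ℕ := localTime τ i t % T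

/-- Slot `t` has an AoI drop of user `i`: the current packet of user `i` is delivered, for the
first time. -/
def IsDrop (T : ℕ) (s : Fin N → ℕ → Bool) (τ : Fin N → Fin L) (i : Fin N) (t : ℕ) : Prop :=
  Succeeds s τ i t ∧
    ∀ t' < t, localTime τ i t' / T = localTime τ i t / T → ¬ Succeeds s τ i t'

open Classical in
/-- Instantaneous AoI of user `i` in slot `t`. The value `a₀` is the age in slot `0` in case
nothing is delivered in that slot. -/
noncomputable def instAoI (T : ℕ) (s : Fin N → ℕ → Bool) (τ : Fin N → Fin L) (i : Fin N)
    (a₀ : ℕ) : ℕ → ℕ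
  | 0 => if IsDrop T s τ i 0 then packetAge T τ i 0 else a₀
  | t + 1 =>
      if IsDrop T s τ i (t + 1) then packetAge T τ i (t + 1) else instAoI T s τ i a₀ t + 1

end System

section Sequence

/-- Length `β` of a superframe. -/
def superLen (T L : ℕ) : ℕ := Nat.lcm T L

/-- Hamming weight `w'` of a sequence over a superframe. -/
def superWt (T L : ℕ) (x : ℕ → Bool) : ℕ := hammingWt (superLen T L) x

/-- Position `y_k` of the `k`-th one (`k = 0, 1, …`) of the sequence `x`. -/
noncomputable def onePos (x : ℕ → Bool) (k : ℕ) : ℕ := Nat.nth (fun t => x t = true) k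

/-- Cyclic distance `ℓ_k` from the `k`-th one to the next one within a superframe, `k < w'`. -/
noncomputable def cycDist (T L : ℕ) (x : ℕ → Bool) (k : ℕ) : ℕ :=
  if k + 1 < superWt T L x then onePos x (k + 1) - onePos x k
  else onePos x 0 + superLen T L - onePos x (superWt T L x - 1)

/-- The position `σ_k` of the `k`-th one within its frame. -/
noncomputable def framePos (T : ℕ) (x : ℕ → Bool) (k : ℕ) : ℕ := onePos x k % T

/-- `ζ_m(k, j) = ∑_{i < j} ℓ_{(k + i) mod m}`. -/
noncomputable def zetaSum (T L : ℕ) (x : ℕ → Bool) (m k j : ℕ) : ℕ :=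
  ∑ i ∈ range j, cycDist T L x ((k + i) % m)

/-- `F₂(ζ_{w'}(k, j)) = ζ_{w'}(k, j) σ_k / β`. -/
noncomputable def F₂ (T L : ℕ) (x : ℕ → Bool) (k j : ℕ) : ℝ :=
  (zetaSum T L x (superWt T L x) k j : ℝ) * (framePos T x k : ℝ) / (superLen T L : ℝ)

/-- `F₃(z) = z² / (2 L)`. -/
noncomputable def F₃ (L : ℕ) (z : ℝ) : ℝ := z ^ 2 / (2 * (L : ℝ))

/-- `B_j = ∑_{k < w'} F₂(ζ_{w'}(k, j)) + ∑_{k < w} F₃(ζ_w(k, j))`, where `w` is the Hamming weight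
of `x` in one period. -/
noncomputable def bCoeff (T L : ℕ) (x : ℕ → Bool) (j : ℕ) : ℝ :=
  ∑ k ∈ range (superWt T L x), F₂ T L x k j
    + ∑ k ∈ range (hammingWt L x), F₃ L (zetaSum T L x (hammingWt L x) k j : ℝ)

/-- The weight `P_r` of each single event with exactly `r` collision-free ones among the `w` ones
of a period, where `0 ^ 0 = 1`. -/
noncomputable def eventProb (N L w r : ℕ) : ℝ :=
  1 / (L : ℝ) ^ (N - 1) *
    ∑ n ∈ Icc (w - r) (N - 1), ∑ m ∈ range (w - r + 1),
      (-1 : ℝ) ^ m * ((N - 1).choose n : ℝ) * ((w - r).choose m : ℝ)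
        * ((w - r - m : ℕ) : ℝ) ^ n * (w : ℝ) ^ n * ((L : ℝ) - (w : ℝ) ^ 2) ^ (N - 1 - n)

end Sequence

/-! ### Periodic sets of natural numbers and the gaps between their elements. -/

section PeriodicPredicates

/-! With at most one `1` per frame, every success delivers a new packet, so the drops are exactly
the collision-free ones of user `i`. Between consecutive deliveries at its `k`-th and `(k + j)`-th
ones, `g` slots apart, the ages run from `σ_k` to `σ_k + g - 1` and add up to `g σ_k + g² / 2 - g /
2`. The gaps of a superframe add up to `β`, whence the term `-1 / 2`; the rest (`gapCost`) is summed
over the pairs `(k, j)` of consecutive deliveries (`tendsto_average_instAoI`).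

Whether a pair is consecutive depends only on the set of free indices modulo `w` (`freeSet`). By the
bound on cross-correlations, another user hits at most one of the `w` ones of a period, and each of
them for exactly `w` of its `L` offsets. Inclusion–exclusion then shows that every set of size `r`
is the free set with the same probability `P_r` (`card_freeSet_eq`). Among the `r`-subsets of a
cycle of length `w`, those with `k` and `k + j` consecutive number `(w - j - 1).choose (r - 2)` if
`r ≥ 2` and `j < w`, while `r = 1` allows only the full turn `j = w` (`sum_consecutive_card`). The
count does not depend on `k`, so for fixed `j` the costs can be summed over `k` first, which gives
`β` times `bCoeff`. -/

theorem infinite_of_periodic {p : ℕ → Prop} {P : ℕ} (hP : 0 < P) (hp : Function.Periodic p P)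
    (h : ∃ n, p n) : (Set.ofPred p).Infinite := by
  obtain ⟨n, hn⟩ := h
  refine Set.infinite_of_forall_exists_gt fun a => ⟨n + (a + 1) * P, ?_, ?_⟩
  · have := hp.nat_mul (a + 1) n
    simp only [Nat.cast_id] at this
    change p _
    rwa [this]
  · nlinarith

theorem nth_add_count_of_periodic {p : ℕ → Prop} [DecidablePred p] {P : ℕ}
    (hp : Function.Periodic p P) (hinf : (Set.ofPred p).Infinite) (m : ℕ) :
    Nat.nth p (m + Nat.count p P) = Nat.nth p m + P := by
  have h1 : Nat.count p (Nat.nth p m + P) = m + Nat.count p P := by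
    have h2 : (fun k => p (k + P)) = p := funext hp
    rw [Nat.count_add']
    simp_rw [h2]
    rw [Nat.count_nth_of_infinite hinf]
  rw [← h1]
  apply Nat.nth_count
  rw [hp]
  exact Nat.nth_mem_of_infinite hinf m

theorem count_mul_of_periodic {p : ℕ → Prop} [DecidablePred p] {P : ℕ}
    (hp : Function.Periodic p P) (c : ℕ) : Nat.count p (P * c) = Nat.count p P * c := by
  induction c with
  | zero => simp
  | succ c ih =>
    have h2 : (fun k => p (k + P)) = p := funext hp
    rw [Nat.mul_succ, Nat.count_add']
    simp_rw [h2]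
    rw [ih, Nat.mul_succ]

theorem sum_range_mul_of_periodic {f : ℕ → ℝ} {P : ℕ} (hf : Function.Periodic f P) (c : ℕ) :
    ∑ k ∈ range (P * c), f k = c * ∑ k ∈ range P, f k := by
  induction c with
  | zero => simp
  | succ c ih =>
    rw [Nat.mul_succ, add_comm, sum_range_add]
    have : ∀ k, f (P + k) = f k := fun k => by rw [add_comm]; exact hf k
    simp_rw [this]
    rw [ih]
    push_cast
    ring

theorem sum_range_count_nth {p : ℕ → Prop} [DecidablePred p] (f : ℕ → ℝ) (n : ℕ) :
    ∑ m ∈ range (Nat.count p n), f (Nat.nth p m) = ∑ k ∈ range n, if p k then f k else 0 := by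
  induction n with
  | zero => simp
  | succ n ih =>
    rw [Nat.count_succ, sum_range_succ _ n]
    split_ifs with h
    · rw [sum_range_succ, ih, Nat.nth_count h]
    · simpa using ih

/-- `k` and `k + j` are consecutive elements of `p`. -/
def Consecutive (p : ℕ → Prop) (k j : ℕ) : Prop :=
  p k ∧ p (k + j) ∧ ∀ u, 0 < u → u < j → ¬ p (k + u)

-- Trades a sum over successive gaps, whose indexing depends on `p`, for a sum over fixed pairs
-- weighted by indicators. Only the latter can be averaged over `p` termwise.
open Classical in
theorem sum_consecutive_nth {p : ℕ → Prop} {w : ℕ} (hw : 0 < w)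
    (hp : Function.Periodic p w) (hinf : (Set.ofPred p).Infinite) (f : ℕ → ℕ → ℝ) (n : ℕ) :
    ∑ m ∈ range (Nat.count p n), f (Nat.nth p m) (Nat.nth p (m + 1) - Nat.nth p m)
      = ∑ k ∈ range n, ∑ j ∈ Icc 1 w, if Consecutive p k j then f k j else 0 := by
  have h := sum_range_count_nth (p := p)
    (fun k => f k (Nat.nth p (Nat.count p k + 1) - k)) n
  simp only [Nat.count_nth_of_infinite hinf] at h
  rw [h]
  refine sum_congr rfl fun k _ => ?_
  split_ifs with hk
  · have hk' : Nat.nth p (Nat.count p k) = k := Nat.nth_count hk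
    have hlt : k < Nat.nth p (Nat.count p k + 1) := by
      conv_lhs => rw [← hk']
      exact (Nat.nth_lt_nth hinf).2 (Nat.lt_succ_self _)
    have hmem : p (Nat.nth p (Nat.count p k + 1)) := Nat.nth_mem_of_infinite hinf _
    have hbetween : ∀ v, k < v → v < Nat.nth p (Nat.count p k + 1) → ¬ p v := by
      intro v hv1 hv2 hv
      have := Nat.le_nth_of_lt_nth_succ hv2 hv
      omega
    -- The next element comes at most one period later, since `k + w` is in `p`; hence the range
    -- `Icc 1 w`.
    have hle : Nat.nth p (Nat.count p k + 1) ≤ k + w := by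
      by_contra hcon
      exact hbetween (k + w) (by omega) (by omega) (by rw [hp]; exact hk)
    set v := Nat.nth p (Nat.count p k + 1)
    rw [sum_eq_single (v - k)]
    · rw [if_pos]
      refine ⟨hk, ?_, fun u h1 h2 => hbetween _ (by omega) (by omega)⟩
      rwa [Nat.add_sub_cancel' hlt.le]
    · intro j hj hne
      rw [if_neg]
      rintro ⟨-, h2, h3⟩
      rw [mem_Icc] at hj
      rcases lt_or_gt_of_ne hne with hlt' | hgt
      · exact hbetween _ (by omega) (by omega) h2
      · exact h3 (v - k) (by omega) hgt (by rwa [Nat.add_sub_cancel' hlt.le])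
    · intro hnot
      exact absurd (mem_Icc.2 ⟨by omega, by omega⟩) hnot
  · symm
    refine sum_eq_zero fun j _ => if_neg fun hc => hk hc.1

end PeriodicPredicates

/-! ### Averages of eventually periodic sequences. -/

/-- All late windows of length `P` have the same sum `V`. Partial sums minus the drift `V / P * n`
are therefore eventually periodic, hence bounded, and vanish after division by `n`. -/
theorem tendsto_average_of_eventually_periodic {a : ℕ → ℝ} {P t₀ : ℕ} (hP : 0 < P)
    (ha : ∀ t, t₀ ≤ t → a (t + P) = a t) :
    Tendsto (fun n : ℕ => (1 / (n : ℝ)) * ∑ t ∈ range (n + 1), a t) atTop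
      (𝓝 ((∑ t ∈ Ico t₀ (t₀ + P), a t) / P)) := by
  set V := ∑ t ∈ Ico t₀ (t₀ + P), a t with hV
  have hwin : ∀ t, t₀ ≤ t → ∑ u ∈ Ico t (t + P), a u = V := by
    intro t ht
    induction t, ht using Nat.le_induction with
    | base => rfl
    | succ t ht ih =>
      have h1 : ∑ u ∈ Ico t (t + P + 1), a u = ∑ u ∈ Ico t (t + P), a u + a (t + P) :=
        sum_Ico_succ_top (by omega) _
      have h2 : ∑ u ∈ Ico t (t + P + 1), a u = a t + ∑ u ∈ Ico (t + 1) (t + P + 1), a u :=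
        sum_eq_sum_Ico_succ_bot (by omega) _
      rw [show t + 1 + P = t + P + 1 by ring]
      linarith [ha t ht]
  set b : ℕ → ℝ := fun n => ∑ t ∈ range (n + 1), a t - V / P * n with hb
  have hP' : (P : ℝ) ≠ 0 := by positivity
  have hbper : ∀ n, t₀ ≤ n → b (n + P) = b n := by
    intro n hn
    have h1 : ∑ t ∈ range (n + P + 1), a t
        = ∑ t ∈ range (n + 1), a t + ∑ t ∈ Ico (n + 1) (n + 1 + P), a t := by
      rw [sum_range_add_sum_Ico _ (by omega)]
      congr 2
      ring
    simp only [hb]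
    rw [h1, hwin (n + 1) (by omega)]
    push_cast
    field_simp
    ring
  obtain ⟨C, hC⟩ : ∃ C, ∀ n, |b n| ≤ C := by
    refine ⟨∑ m ∈ range (t₀ + P), |b m|, fun n => ?_⟩
    induction n using Nat.strong_induction_on with
    | _ n ih =>
      by_cases hn : n < t₀ + P
      · exact single_le_sum (f := fun m => |b m|) (fun _ _ => abs_nonneg _) (mem_range.2 hn)
      · have := hbper (n - P) (by omega)
        rw [Nat.sub_add_cancel (by omega)] at this
        rw [this]
        exact ih _ (by omega)
  have hlim : Tendsto (fun n : ℕ => b n * (1 / (n : ℝ))) atTop (𝓝 0) :=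
    bdd_le_mul_tendsto_zero' C (Eventually.of_forall hC) tendsto_one_div_atTop_nhds_zero_nat
  have hlim2 : Tendsto (fun n : ℕ => b n * (1 / (n : ℝ)) + V / P) atTop (𝓝 (0 + V / P)) :=
    hlim.add tendsto_const_nhds
  rw [zero_add] at hlim2
  refine hlim2.congr' ?_
  filter_upwards [eventually_gt_atTop 0] with n hn
  have : (n : ℝ) ≠ 0 := by positivity
  simp only [hb]
  field_simp
  ring

/-! ### Inclusion–exclusion. -/

section Counting

/-- After reversal this is the `q`-th forward difference at `0` of a polynomial of degree less than
`q`. -/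
theorem sum_neg_one_pow_choose_mul_pow_eq_zero {n q : ℕ} (h : n < q) :
    ∑ m ∈ range (q + 1), (-1 : ℝ) ^ m * (q.choose m : ℝ) * ((q - m : ℕ) : ℝ) ^ n = 0 := by
  have h1 : (fwdDiff (1 : ℝ))^[q] (fun x : ℝ => x ^ n) 0 = 0 := by
    rw [fwdDiff_iter_pow_eq_zero_of_lt h]; rfl
  rw [fwdDiff_iter_eq_sum_shift] at h1
  rw [← sum_range_reflect, ← h1]
  refine sum_congr rfl fun k hk => ?_
  have hk' : k ≤ q := by rw [mem_range] at hk; omega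
  have e : q + 1 - 1 - k = q - k := by omega
  rw [e, Nat.sub_sub_self hk', Nat.choose_symm hk']
  simp

/-- For `B ⊆ Q` the sum runs over the `X ⊆ Q \ B`, and an alternating sum over a power set vanishes
unless the ground set is empty. -/
theorem sum_powerset_neg_one_pow_card_disjoint {α : Type*} [DecidableEq α] (Q B : Finset α) :
    (∑ X ∈ Q.powerset, if B ⊆ Q \ X then (-1 : ℝ) ^ #X else 0) = if B = Q then 1 else 0 := by
  by_cases hB : B ⊆ Q
  · have h1 : (∑ X ∈ Q.powerset, if B ⊆ Q \ X then (-1 : ℝ) ^ #X else 0)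
        = ∑ X ∈ (Q \ B).powerset, (-1 : ℝ) ^ #X := by
      rw [← sum_filter]
      refine sum_congr ?_ fun _ _ => rfl
      ext X
      simp only [mem_filter, mem_powerset, subset_sdiff]
      constructor
      · rintro ⟨h1, -, h2⟩
        exact ⟨h1, h2.symm⟩
      · rintro ⟨h1, h2⟩
        exact ⟨h1, hB, h2.symm⟩
    have h2 := sum_powerset_neg_one_pow_card (x := Q \ B)
    have h3 : (∑ X ∈ (Q \ B).powerset, (-1 : ℝ) ^ #X) = if Q \ B = ∅ then 1 else 0 := by
      exact_mod_cast h2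
    rw [h1, h3]
    refine if_congr ?_ rfl rfl
    rw [sdiff_eq_empty_iff_subset]
    exact ⟨fun h => hB.antisymm h, fun h => h.symm.subset⟩
  · rw [if_neg (fun h => hB h.subset)]
    exact sum_eq_zero fun X _ => if_neg fun h => hB (h.trans sdiff_subset)

open Classical in
/-- Number of points at which the set-valued map `B` takes the value `Q`, when the number of
points with `B ⊆ R` depends on `R ⊆ Q` through its size only. -/
theorem card_fiber_eq_sum {Ω α : Type*} [Fintype Ω] [DecidableEq α] (B : Ω → Finset α)
    (Q : Finset α) (c : ℕ → ℝ)
    (hc : ∀ R ⊆ Q, (#{x : Ω | B x ⊆ R} : ℝ) = c #R) :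
    (#{x : Ω | B x = Q} : ℝ)
      = ∑ m ∈ range (#Q + 1), (-1 : ℝ) ^ m * ((#Q).choose m : ℝ) * c (#Q - m) := by
  have h1 : (#{x : Ω | B x = Q} : ℝ) = ∑ x : Ω, if B x = Q then (1 : ℝ) else 0 := by
    rw [card_filter]; push_cast; rfl
  rw [h1]
  simp_rw [← sum_powerset_neg_one_pow_card_disjoint Q]
  rw [sum_comm]
  have h2 : ∀ X ∈ Q.powerset, (∑ x : Ω, if B x ⊆ Q \ X then (-1 : ℝ) ^ #X else 0)
      = (-1 : ℝ) ^ #X * c (#Q - #X) := by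
    intro X hX
    rw [← sum_filter, sum_const, nsmul_eq_mul, hc _ sdiff_subset,
      card_sdiff_of_subset (mem_powerset.1 hX), mul_comm]
  rw [sum_congr rfl h2, sum_powerset_apply_card (fun m => (-1 : ℝ) ^ m * c (#Q - m))]
  refine sum_congr rfl fun m _ => ?_
  rw [nsmul_eq_mul]
  ring

end Counting

/-! ### Subsets of a cycle with two prescribed consecutive elements. -/

section CyclicCounting

theorem exists_lt_add_mod_eq {w x : ℕ} (k : ℕ) (hx : x < w) : ∃ u < w, (k + u) % w = x := by
  have hk : k % w < w := Nat.mod_lt _ (by omega)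
  by_cases h : k % w ≤ x
  · refine ⟨x - k % w, by omega, ?_⟩
    rw [← Nat.mod_add_mod, Nat.add_sub_cancel' h, Nat.mod_eq_of_lt hx]
  · refine ⟨x + w - k % w, by omega, ?_⟩
    rw [← Nat.mod_add_mod, Nat.add_sub_cancel' (by omega), Nat.add_mod_right,
      Nat.mod_eq_of_lt hx]

theorem eq_of_add_mod_eq {w k u v : ℕ} (hu : u < w) (hv : v < w)
    (h : (k + u) % w = (k + v) % w) : u = v :=
  Nat.ModEq.eq_of_lt_of_lt (Nat.ModEq.add_left_cancel' k h) hu hv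

theorem consecutive_period_iff {w : ℕ} (hw : 0 < w) {S : Finset ℕ} (hS : S ⊆ range w) (k : ℕ) :
    Consecutive (fun n => n % w ∈ S) k w ↔ S = {k % w} := by
  constructor
  · rintro ⟨h1, -, h3⟩
    ext x
    rw [mem_singleton]
    constructor
    · intro hx
      obtain ⟨u, hu, rfl⟩ := exists_lt_add_mod_eq k (mem_range.1 (hS hx))
      rcases Nat.eq_zero_or_pos u with rfl | hpos
      · rfl
      · exact absurd hx (h3 u hpos hu)
    · rintro rfl
      exact h1
  · rintro rfl
    refine ⟨mem_singleton_self _, by simp, fun u h1 h2 h3 => ?_⟩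
    replace h3 := mem_singleton.1 h3
    have := eq_of_add_mod_eq (v := 0) h2 hw h3
    omega

open Classical in
theorem card_consecutive_period {w : ℕ} (hw : 0 < w) (k r : ℕ) :
    #{S ∈ (range w).powerset | #S = r ∧ Consecutive (fun n => n % w ∈ S) k w}
      = if r = 1 then 1 else 0 := by
  split_ifs with hr
  · rw [card_eq_one]
    refine ⟨{k % w}, ?_⟩
    ext S
    rw [mem_filter, mem_powerset, mem_singleton]
    constructor
    · rintro ⟨h1, -, h2⟩
      exact (consecutive_period_iff hw h1 k).1 h2
    · rintro rfl
      have h1 : {k % w} ⊆ range w := by simpa using Nat.mod_lt k hw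
      exact ⟨h1, by simp [hr], (consecutive_period_iff hw h1 k).2 rfl⟩
  · rw [card_eq_zero, filter_eq_empty_iff]
    rintro S hS ⟨h1, h2⟩
    rw [(consecutive_period_iff hw (mem_powerset.1 hS) k).1 h2, card_singleton] at h1
    exact hr h1.symm

open Classical in
theorem card_consecutive_one {w k j : ℕ} (hj : 0 < j) (hjw : j < w) :
    #{S ∈ (range w).powerset | #S = 1 ∧ Consecutive (fun n => n % w ∈ S) k j} = 0 := by
  rw [card_eq_zero, filter_eq_empty_iff]
  rintro S - ⟨h1, h2, h3, -⟩
  have := card_le_one.1 h1.le _ h2 _ h3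
  have := eq_of_add_mod_eq (u := 0) (hj.trans hjw) hjw this
  omega

-- Such an `S` meets the arc `C` from `k` to `k + j` in its two endpoints only. Its other `r - 2`
-- elements are arbitrary among the `w - j - 1` residues off the arc.
open Classical in
theorem card_consecutive_of_lt {w k j r : ℕ} (hj : 0 < j) (hjw : j < w) (hr : 2 ≤ r) :
    #{S ∈ (range w).powerset | #S = r ∧ Consecutive (fun n => n % w ∈ S) k j}
      = (w - j - 1).choose (r - 2) := by
  have hw : 0 < w := by omega
  set C := (range (j + 1)).image (fun u => (k + u) % w) with hC
  have hCw : C ⊆ range w := by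
    intro x hx
    obtain ⟨u, -, rfl⟩ := mem_image.1 hx
    exact mem_range.2 (Nat.mod_lt _ hw)
  have hCcard : #C = j + 1 := by
    rw [hC, card_image_of_injOn, card_range]
    intro u hu v hv h
    simp only [coe_range, Set.mem_Iio] at hu hv
    exact eq_of_add_mod_eq (by omega) (by omega) h
  have hne : k % w ≠ (k + j) % w := fun h => by
    have := eq_of_add_mod_eq (u := 0) hw hjw h
    omega
  have h0 : k % w ∈ C := mem_image.2 ⟨0, by simp, rfl⟩
  have hjC : (k + j) % w ∈ C := mem_image.2 ⟨j, by simp, rfl⟩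
  have hends : ({k % w, (k + j) % w} : Finset ℕ) ⊆ C := by
    intro x hx
    rw [mem_insert, mem_singleton] at hx
    rcases hx with rfl | rfl <;> assumption
  have hcardD : #(range w \ C) = w - j - 1 := by
    rw [card_sdiff_of_subset hCw, card_range, hCcard]
    omega
  rw [← hcardD, ← card_powersetCard]
  have hinter : ∀ S, Consecutive (fun n => n % w ∈ S) k j →
      S ∩ C = {k % w, (k + j) % w} := by
    rintro S ⟨h1, h2, h3⟩
    ext x
    rw [mem_inter, mem_insert, mem_singleton]
    constructor
    · rintro ⟨hxS, hxC⟩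
      obtain ⟨u, hu, rfl⟩ := mem_image.1 hxC
      rw [mem_range] at hu
      rcases Nat.eq_zero_or_pos u with rfl | hpos
      · exact Or.inl rfl
      · rcases (Nat.lt_succ_iff.1 hu).lt_or_eq with hlt | rfl
        · exact absurd hxS (h3 u hpos hlt)
        · exact Or.inr rfl
    · rintro (rfl | rfl)
      · exact ⟨h1, h0⟩
      · exact ⟨h2, hjC⟩
  refine card_nbij' (fun S => S \ C) (fun X => X ∪ {k % w, (k + j) % w}) ?_ ?_ ?_ ?_
  · intro S hS
    simp only [coe_filter, Set.mem_ofPred_eq, mem_powerset] at hS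
    obtain ⟨h1, h2, h3⟩ := hS
    rw [mem_coe, mem_powersetCard]
    refine ⟨sdiff_subset_sdiff h1 subset_rfl, ?_⟩
    change #(S \ C) = r - 2
    have h4 := card_sdiff_add_card_inter S C
    rw [hinter S h3, card_pair hne] at h4
    omega
  · intro X hX
    rw [mem_coe, mem_powersetCard, subset_sdiff] at hX
    obtain ⟨⟨h1, h2⟩, h3⟩ := hX
    simp only [coe_filter, Set.mem_ofPred_eq, mem_powerset]
    refine ⟨union_subset h1 (hends.trans hCw), ?_, ?_, ?_, ?_⟩
    · rw [card_union_of_disjoint (h2.mono_right hends), card_pair hne]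
      omega
    · simp
    · simp
    · intro u hu1 hu2 hmem
      rw [mem_union, mem_insert, mem_singleton] at hmem
      rcases hmem with hmem | hmem | hmem
      · exact disjoint_left.1 h2 hmem (mem_image.2 ⟨u, by rw [mem_range]; omega, rfl⟩)
      · have := eq_of_add_mod_eq (v := 0) (by omega) hw hmem
        omega
      · have := eq_of_add_mod_eq (by omega) hjw hmem
        omega
  · intro S hS
    simp only [coe_filter, Set.mem_ofPred_eq] at hS
    change S \ C ∪ {k % w, (k + j) % w} = S
    rw [← hinter S hS.2.2, sdiff_union_inter]
  · intro X hX
    rw [mem_coe, mem_powersetCard, subset_sdiff] at hX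
    change (X ∪ {k % w, (k + j) % w}) \ C = X
    rw [union_sdiff_distrib, sdiff_eq_self_of_disjoint hX.1.2, sdiff_eq_empty_iff_subset.2 hends,
      union_empty]

open Classical in
/-- Sum over the subsets of a cycle of length `w` that have two given consecutive elements, for a
weight that depends on the size of the subset only. -/
theorem sum_consecutive_card {w : ℕ} (hw : 0 < w) (P : ℕ → ℝ) (k j : ℕ) (hj : j ∈ Icc 1 w) :
    ∑ S ∈ (range w).powerset, (if Consecutive (fun n => n % w ∈ S) k j then P #S else 0)
      = P 1 * (if j = w then 1 else 0)
        + ∑ r ∈ Icc 2 w, P r * (if j < w then ((w - j - 1).choose (r - 2) : ℝ) else 0) := by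
  rw [mem_Icc] at hj
  have hmaps : ∀ S ∈ {S ∈ (range w).powerset | Consecutive (fun n => n % w ∈ S) k j},
      #S ∈ Icc 1 w := by
    intro S hS
    rw [mem_filter, mem_powerset] at hS
    rw [mem_Icc]
    refine ⟨card_pos.2 ⟨_, hS.2.1⟩, ?_⟩
    simpa using card_le_card hS.1
  rw [← sum_filter, ← sum_fiberwise_of_maps_to hmaps]
  have hfib : ∀ r, (∑ S ∈ {S ∈ (range w).powerset | Consecutive (fun n => n % w ∈ S) k j} with
      #S = r, P #S) = P r *
      (#{S ∈ (range w).powerset | #S = r ∧ Consecutive (fun n => n % w ∈ S) k j} : ℝ) := by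
    intro r
    rw [sum_congr rfl (g := fun _ => P r) (fun S hS => by rw [(mem_filter.1 hS).2]), sum_const,
      nsmul_eq_mul, mul_comm, filter_filter]
    simp_rw [and_comm]
  simp_rw [hfib]
  rw [← add_sum_Ioc_eq_sum_Icc (by omega : 1 ≤ w)]
  have hI : Ioc 1 w = Icc 2 w := by ext; simp [mem_Ioc, mem_Icc]; omega
  rw [hI]
  rcases hj.2.lt_or_eq with hlt | rfl
  · rw [card_consecutive_one hj.1 hlt, if_neg hlt.ne]
    simp only [Nat.cast_zero]
    congr 1
    refine sum_congr rfl fun r hr => ?_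
    rw [mem_Icc] at hr
    rw [card_consecutive_of_lt hj.1 hlt hr.1, if_pos hlt]
  · rw [card_consecutive_period hw]
    simp only [if_true, Nat.cast_one, lt_irrefl, if_false]
    congr 1
    refine sum_congr rfl fun r hr => ?_
    rw [mem_Icc] at hr
    rw [card_consecutive_period hw, if_neg (by omega)]
    simp

end CyclicCounting

/-! ### Distribution of the set of collision-free ones. -/

section Collisions

variable {N L : ℕ}

/-- The `k`-th one of user `i` is not hit by any other user, for the offsets `τ`. -/
def CollisionFree (s : Fin N → ℕ → Bool) (τ : Fin N → Fin L) (i : Fin N) (k : ℕ) : Prop :=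
  ∀ j, j ≠ i → ¬ s j (onePos (s i) k + (L - (τ i : ℕ)) + (τ j : ℕ)) = true

theorem hammingWt_eq_count (P : ℕ) (x : ℕ → Bool) :
    hammingWt P x = Nat.count (fun t => x t = true) P := by
  rw [Nat.count_eq_card_filter_range]
  rfl

theorem periodic_ones {x : ℕ → Bool} {P : ℕ} (hx : Function.Periodic x P) :
    Function.Periodic (fun t => x t = true) P := fun t => by
  change (x (t + P) = true) = (x t = true)
  rw [hx]

theorem infinite_ones {x : ℕ → Bool} (hx : Function.Periodic x L) (hwt : 0 < hammingWt L x) :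
    (Set.ofPred fun t => x t = true).Infinite := by
  rw [hammingWt_eq_count] at hwt
  obtain ⟨t, ht, h⟩ := Nat.count_ne_iff_exists.1 hwt.ne'
  exact infinite_of_periodic (by omega) (periodic_ones hx) ⟨t, h⟩

theorem onePos_add_hammingWt {x : ℕ → Bool} (hx : Function.Periodic x L)
    (hwt : 0 < hammingWt L x) {P : ℕ} (hP : Function.Periodic x P) (k : ℕ) :
    onePos x (k + hammingWt P x) = onePos x k + P := by
  rw [hammingWt_eq_count]
  exact nth_add_count_of_periodic (periodic_ones hP) (infinite_ones hx hwt) k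

theorem card_shift_ones {x : ℕ → Bool} (hx : Function.Periodic x L) (e : ℕ) :
    #{d : Fin L | x (e + (d : ℕ)) = true} = hammingWt L x := by
  have h1 : #{d : Fin L | x (e + (d : ℕ)) = true} = #{d ∈ range L | x (e + d) = true} := by
    rw [card_filter, card_filter]
    exact Fin.sum_univ_eq_sum_range (fun d => if x (e + d) = true then 1 else 0) L
  rw [h1, ← Nat.count_eq_card_filter_range, hammingWt_eq_count]
  have h2 := Nat.count_add (fun t => x t = true) e L
  have h3 := Nat.count_add' (fun t => x t = true) e L
  have h4 : (fun t => x (t + L) = true) = fun t => x t = true := periodic_ones hx |> funext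
  simp_rw [h4] at h3
  omega

theorem eq_of_two_collisions {s : Fin N → ℕ → Bool} (hs : IsMHUI N L s) {i j : Fin N}
    (hij : i ≠ j) {t t' e : ℕ} (ht : t < L) (ht' : t' < L)
    (h1 : s i t = true) (h1' : s i t' = true)
    (h2 : s j (t + e) = true) (h2' : s j (t' + e) = true) : t = t' := by
  by_contra hne
  -- The correlation bound covers only offsets below `L`, so `e` is reduced modulo `L`.
  have hmod : ∀ u, s j (u + e % L) = s j (u + e) := by
    intro u
    rw [← (hs.periodic j).map_mod_nat, Nat.add_mod_mod, (hs.periodic j).map_mod_nat]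
  have hle := hs.crossCorr_le i j hij (e % L) (Nat.mod_lt _ (by omega))
  have hsub : ({t, t'} : Finset ℕ) ⊆ range L := by
    intro u hu
    rw [mem_insert, mem_singleton] at hu
    rw [mem_range]
    rcases hu with rfl | rfl <;> assumption
  have hge : ∑ u ∈ ({t, t'} : Finset ℕ), (s i u).toNat * (s j (u + e % L)).toNat
      ≤ crossCorr L (s i) (s j) (e % L) := sum_le_sum_of_subset hsub
  rw [sum_pair hne, hmod, hmod, h1, h1', h2, h2'] at hge
  simp at hge
  omega

theorem onePos_spec {x : ℕ → Bool} (hx : Function.Periodic x L) (hwt : 0 < hammingWt L x) (k : ℕ) :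
    x (onePos x k) = true :=
  Nat.nth_mem_of_infinite (infinite_ones hx hwt) k

theorem onePos_strictMono {x : ℕ → Bool} (hx : Function.Periodic x L)
    (hwt : 0 < hammingWt L x) : StrictMono (onePos x) :=
  Nat.nth_strictMono (infinite_ones hx hwt)

theorem onePos_lt {x : ℕ → Bool} {k : ℕ} (hk : k < hammingWt L x) : onePos x k < L := by
  rw [hammingWt_eq_count] at hk
  exact Nat.nth_lt_of_lt_count hk

theorem onePos_eq_of_two_collisions {s : Fin N → ℕ → Bool} (hs : IsMHUI N L s) {i j : Fin N}
    (hij : j ≠ i) {k k' e : ℕ} (hk : k < hammingWt L (s i)) (hk' : k' < hammingWt L (s i))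
    (h : s j (onePos (s i) k + e) = true) (h' : s j (onePos (s i) k' + e) = true) : k = k' := by
  have hwt : 0 < hammingWt L (s i) := by omega
  exact (onePos_strictMono (hs.periodic i) hwt).injective
    (eq_of_two_collisions hs hij.symm (onePos_lt hk) (onePos_lt hk')
      (onePos_spec (hs.periodic i) hwt k) (onePos_spec (hs.periodic i) hwt k') h h')

/-- The offsets of user `j` for which it hits none of the ones of user `i` with index in `U`. -/
noncomputable def safeOffsets (s : Fin N → ℕ → Bool) (i j : Fin N) (U : Finset ℕ) (e : ℕ) :
    Finset (Fin L) :=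
  {d : Fin L | ∀ k ∈ U, ¬ s j (onePos (s i) k + e + (d : ℕ)) = true}

/-- The sets of offsets hitting different ones of `U` are disjoint, since two hits at one offset
would violate the correlation bound. -/
theorem card_safeOffsets {s : Fin N → ℕ → Bool} (hs : IsMHUI N L s) {i j : Fin N} (hij : j ≠ i)
    {U : Finset ℕ} (hU : U ⊆ range (hammingWt L (s i))) (e : ℕ) :
    #(safeOffsets (L := L) s i j U e) + #U * hammingWt L (s j) = L := by
  have h1 : #(U.biUnion fun k => {d : Fin L | s j (onePos (s i) k + e + (d : ℕ)) = true})
      = #U * hammingWt L (s j) := by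
    rw [card_biUnion, sum_congr rfl (fun k _ => card_shift_ones (hs.periodic j) _), sum_const,
      smul_eq_mul]
    intro k hk k' hk' hne
    refine disjoint_left.2 fun d hd hd' => ?_
    simp only [mem_filter] at hd hd'
    refine hne (onePos_eq_of_two_collisions hs hij (e := e + d) (mem_range.1 (hU hk))
      (mem_range.1 (hU hk')) ?_ ?_)
    · rw [← add_assoc]; exact hd.2
    · rw [← add_assoc]; exact hd'.2
  have h2 : safeOffsets (L := L) s i j U e
      = (U.biUnion fun k => {d : Fin L | s j (onePos (s i) k + e + (d : ℕ)) = true})ᶜ := by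
    ext d
    simp [safeOffsets]
  rw [← h1, h2, card_compl_add_card, Fintype.card_fin]

open Classical in
/-- The indices of the collision-free ones of user `i` in one period. -/
noncomputable def freeSet (s : Fin N → ℕ → Bool) (i : Fin N) (τ : Fin N → Fin L) : Finset ℕ :=
  {k ∈ range (hammingWt L (s i)) | CollisionFree s τ i k}

-- Once `τ i` is fixed (`L` choices), the other offsets are constrained independently: each must
-- avoid the `w - #R` ones outside `R`, which leaves `L - w * (w - #R)` values.
open Classical in
theorem card_superset_freeSet {s : Fin N → ℕ → Bool} (hs : IsMHUI N L s) {w : ℕ}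
    (hw : ∀ j, hammingWt L (s j) = w) (i : Fin N) {R : Finset ℕ} (hR : R ⊆ range w) :
    (#{τ : Fin N → Fin L | range w \ freeSet s i τ ⊆ R} : ℝ)
      = L * ((w : ℝ) * #R + ((L : ℝ) - (w : ℝ) ^ 2)) ^ (N - 1) := by
  set U := range w \ R with hU
  have hUw : U ⊆ range (hammingWt L (s i)) := by rw [hw]; exact sdiff_subset
  have hmem : ∀ τ : Fin N → Fin L, range w \ freeSet s i τ ⊆ R ↔
      ∀ j, j ≠ i → τ j ∈ safeOffsets s i j U (L - (τ i : ℕ)) := by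
    intro τ
    simp only [safeOffsets, mem_filter, mem_univ, true_and]
    constructor
    · intro h j hj k hk hcon
      rw [hU, Finset.mem_sdiff] at hk
      refine hk.2 (h (Finset.mem_sdiff.2 ⟨hk.1, fun hk2 => ?_⟩))
      exact (mem_filter.1 hk2).2 j hj hcon
    · intro h k hk
      rw [Finset.mem_sdiff] at hk
      by_contra hkR
      refine hk.2 (mem_filter.2 ⟨by rw [hw]; exact hk.1, fun j hj => ?_⟩)
      exact h j hj k (Finset.mem_sdiff.2 ⟨hk.1, hkR⟩)
  have hcard : ∀ c : Fin L, (#{τ : Fin N → Fin L | (range w \ freeSet s i τ ⊆ R) ∧ τ i = c} : ℝ)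
      = ((w : ℝ) * #R + ((L : ℝ) - (w : ℝ) ^ 2)) ^ (N - 1) := by
    intro c
    have h1 : ({τ : Fin N → Fin L | (range w \ freeSet s i τ ⊆ R) ∧ τ i = c} : Finset _)
        = Fintype.piFinset fun j => if j = i then {c} else safeOffsets s i j U (L - (c : ℕ)) := by
      ext τ
      rw [mem_filter, Fintype.mem_piFinset, hmem]
      constructor
      · rintro ⟨-, h, rfl⟩ j
        by_cases hj : j = i
        · subst hj; simp
        · rw [if_neg hj]; exact h j hj
      · intro h
        have hi : τ i = c := by simpa using h i
        refine ⟨mem_univ _, fun j hj => ?_, hi⟩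
        have := h j
        rwa [if_neg hj, ← hi] at this
    rw [h1, Fintype.card_piFinset, Nat.cast_prod, ← mul_prod_erase univ _ (mem_univ i), if_pos rfl,
      card_singleton, Nat.cast_one, one_mul]
    rw [prod_congr rfl (g := fun _ => (w : ℝ) * #R + ((L : ℝ) - (w : ℝ) ^ 2)), prod_const,
      card_erase_of_mem (mem_univ i), card_univ, Fintype.card_fin]
    intro j hj
    have hji := (mem_erase.1 hj).1
    rw [if_neg hji]
    have h2 := card_safeOffsets hs hji hUw (L - (c : ℕ))
    have h3 : #U + #R = w := by
      have := card_sdiff_add_card_eq_card hR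
      rwa [card_range] at this
    rw [hw] at h2
    have h2' : (#(safeOffsets (L := L) s i j U (L - (c : ℕ))) : ℝ) + #U * w = L := by
      exact_mod_cast h2
    have h3' : (#U : ℝ) + #R = w := by exact_mod_cast h3
    linear_combination h2' - (w : ℝ) * h3'
  rw [card_eq_sum_card_fiberwise (f := fun τ => τ i) (t := univ)
    (fun _ _ => mem_coe.2 (mem_univ _)), Nat.cast_sum]
  simp_rw [filter_filter]
  rw [sum_congr rfl fun c _ => hcard c, sum_const, card_univ, Fintype.card_fin, nsmul_eq_mul]

/-- Binomial expansion; the powers `v < q` cancel as finite differences, which explains the lower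
limit `w - r` in `P_r`. -/
theorem sum_neg_one_pow_choose_mul_add_pow (q n : ℕ) (a b : ℝ) :
    ∑ m ∈ range (q + 1), (-1 : ℝ) ^ m * (q.choose m : ℝ) * (a * ((q - m : ℕ) : ℝ) + b) ^ n
      = ∑ v ∈ Icc q n, ∑ m ∈ range (q + 1),
          (-1 : ℝ) ^ m * (n.choose v : ℝ) * (q.choose m : ℝ) * ((q - m : ℕ) : ℝ) ^ v * a ^ v
            * b ^ (n - v) := by
  have hsub : Icc q n ⊆ range (n + 1) := by
    intro v hv
    rw [mem_Icc] at hv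
    rw [mem_range]
    omega
  rw [sum_subset hsub]
  · simp_rw [add_pow, mul_sum]
    rw [sum_comm]
    refine sum_congr rfl fun v _ => sum_congr rfl fun m _ => ?_
    rw [mul_pow]
    ring
  · intro v hv hv'
    rw [mem_range] at hv
    rw [mem_Icc] at hv'
    have h0 := sum_neg_one_pow_choose_mul_pow_eq_zero (n := v) (q := q) (by omega)
    calc _ = (n.choose v : ℝ) * a ^ v * b ^ (n - v) *
          ∑ m ∈ range (q + 1), (-1 : ℝ) ^ m * (q.choose m : ℝ) * ((q - m : ℕ) : ℝ) ^ v := by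
          rw [mul_sum]
          refine sum_congr rfl fun m _ => ?_
          ring
      _ = 0 := by rw [h0, mul_zero]

-- Inclusion–exclusion applied to the set of blocked ones, the complement of the free set.
open Classical in
theorem card_freeSet_eq {s : Fin N → ℕ → Bool} (hs : IsMHUI N L s) {w : ℕ}
    (hw : ∀ j, hammingWt L (s j) = w) (hL : 0 < L) (i : Fin N) {S : Finset ℕ}
    (hS : S ⊆ range w) :
    (#{τ : Fin N → Fin L | freeSet s i τ = S} : ℝ) = (L : ℝ) ^ N * eventProb N L w #S := by
  have hfree : ∀ τ, freeSet (L := L) s i τ ⊆ range w := fun τ => by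
    rw [← hw i]; exact filter_subset _ _
  have h1 : (univ.filter fun τ : Fin N → Fin L => freeSet s i τ = S)
      = univ.filter fun τ => range w \ freeSet s i τ = range w \ S := by
    refine filter_congr fun τ _ => ⟨fun h => by rw [h], fun h => ?_⟩
    rw [← Finset.sdiff_sdiff_eq_self (hfree τ), h, Finset.sdiff_sdiff_eq_self hS]
  have hq : #(range w \ S) = w - #S := by rw [card_sdiff_of_subset hS, card_range]
  rw [h1, card_fiber_eq_sum _ _
    (fun r => L * ((w : ℝ) * r + ((L : ℝ) - (w : ℝ) ^ 2)) ^ (N - 1))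
    (fun R hR => card_superset_freeSet hs hw i (hR.trans sdiff_subset)), hq]
  have hN : N = N - 1 + 1 := by have := i.pos; omega
  have hL' : (L : ℝ) ≠ 0 := by positivity
  have h2 := sum_neg_one_pow_choose_mul_add_pow (w - #S) (N - 1) (w : ℝ) ((L : ℝ) - (w : ℝ) ^ 2)
  rw [eventProb, ← h2]
  calc _ = (L : ℝ) * ∑ m ∈ range (w - #S + 1), (-1 : ℝ) ^ m * ((w - #S).choose m : ℝ) *
        (w * ((w - #S - m : ℕ) : ℝ) + ((L : ℝ) - (w : ℝ) ^ 2)) ^ (N - 1) := by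
        rw [mul_sum]
        refine sum_congr rfl fun m _ => ?_
        ring
    _ = _ := by
        rw [← mul_assoc, mul_one_div]
        conv_rhs => rw [show (L : ℝ) ^ N = L ^ (N - 1 + 1) by rw [← hN]]
        rw [pow_succ (L : ℝ) (N - 1), mul_div_cancel_left₀ _ (pow_ne_zero _ hL')]

/-- If all ones were hit, choosing a culprit for each would inject at least `N` ones into the `N -
1` other users. -/
theorem freeSet_nonempty {s : Fin N → ℕ → Bool} (hs : IsMHUI N L s) (i : Fin N)
    (τ : Fin N → Fin L) : (freeSet s i τ).Nonempty := by
  classical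
  by_contra hempty
  rw [not_nonempty_iff_eq_empty] at hempty
  have h1 : ∀ k : Fin (hammingWt L (s i)), ∃ j, j ≠ i ∧
      s j (onePos (s i) k + (L - (τ i : ℕ)) + (τ j : ℕ)) = true := by
    intro k
    by_contra hcon
    push Not at hcon
    have : (k : ℕ) ∈ freeSet s i τ :=
      mem_filter.2 ⟨mem_range.2 k.2, fun j hj h => hcon j hj h⟩
    rw [hempty] at this
    exact notMem_empty _ this
  choose f hf1 hf2 using h1
  have hinj : Function.Injective f := by
    intro k k' hkk'
    have h2 := hf2 k'
    rw [← hkk'] at h2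
    refine Fin.ext (onePos_eq_of_two_collisions hs (hf1 k) (e := L - (τ i : ℕ) + (τ (f k) : ℕ))
      k.2 k'.2 ?_ ?_)
    · rw [← add_assoc]; exact hf2 k
    · rw [← add_assoc]; exact h2
  have hsub : univ.image f ⊆ univ.erase i := by
    intro j hj
    obtain ⟨k, -, rfl⟩ := mem_image.1 hj
    exact mem_erase.2 ⟨hf1 k, mem_univ _⟩
  have hle := card_le_card hsub
  rw [card_image_of_injective _ hinj, card_erase_of_mem (mem_univ i)] at hle
  simp only [card_univ, Fintype.card_fin] at hle
  have := hs.le_weight i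
  have := i.pos
  omega

end Collisions

/-! ### Gap lengths and costs over a superframe. -/

section Superframe

variable {T L : ℕ} {x : ℕ → Bool}

theorem superLen_eq (T L : ℕ) : superLen T L = L * (superLen T L / L) :=
  (Nat.mul_div_cancel' (Nat.dvd_lcm_right T L)).symm

theorem superLen_pos (hT : 0 < T) (hL : 0 < L) : 0 < superLen T L := Nat.lcm_pos hT hL

theorem periodic_superLen (T : ℕ) (hx : Function.Periodic x L) :
    Function.Periodic x (superLen T L) := by
  rw [superLen_eq, mul_comm]
  exact hx.nat_mul _

theorem superWt_eq (T : ℕ) (hx : Function.Periodic x L) :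
    superWt T L x = hammingWt L x * (superLen T L / L) := by
  rw [superWt, superLen_eq, hammingWt_eq_count, hammingWt_eq_count,
    count_mul_of_periodic (periodic_ones hx), ← superLen_eq]

theorem hammingWt_le_superWt (hT : 0 < T) (hL : 0 < L) (hx : Function.Periodic x L) :
    hammingWt L x ≤ superWt T L x := by
  rw [superWt_eq T hx]
  exact Nat.le_mul_of_pos_right _ (Nat.div_pos
    (Nat.le_of_dvd (superLen_pos hT hL) (Nat.dvd_lcm_right T L)) hL)

theorem onePos_add_superWt (T : ℕ) (hx : Function.Periodic x L) (hwt : 0 < hammingWt L x)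
    (k : ℕ) : onePos x (k + superWt T L x) = onePos x k + superLen T L :=
  onePos_add_hammingWt hx hwt (periodic_superLen T hx) k

theorem cycDist_eq (hx : Function.Periodic x L) (hwt : 0 < hammingWt L x) {k : ℕ}
    (hk : k < superWt T L x) : cycDist T L x k = onePos x (k + 1) - onePos x k := by
  rw [cycDist]
  split_ifs with h
  · rfl
  · have hk' : k + 1 = 0 + superWt T L x := by omega
    rw [hk', onePos_add_superWt T hx hwt, ← (by omega : k = superWt T L x - 1)]

/-- The gaps are `m`-periodic in the index, so the reduction modulo `m` is harmless and the sum
telescopes. It serves both `(w, L)` and `(w', β)` as `(m, P)`. -/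
theorem zetaSum_eq (hx : Function.Periodic x L) (hwt : 0 < hammingWt L x) {m P : ℕ}
    (hm : 0 < m) (hm' : m ≤ superWt T L x) (hP : ∀ k, onePos x (k + m) = onePos x k + P)
    (k j : ℕ) : (zetaSum T L x m k j : ℝ) = (onePos x (k + j) : ℝ) - onePos x k := by
  have hper : Function.Periodic (fun k => onePos x (k + 1) - onePos x k) m := fun k => by
    simp only
    rw [add_right_comm, hP, hP]
    omega
  have h1 : ∀ n, cycDist T L x (n % m) = onePos x (n + 1) - onePos x n := fun n => by
    rw [cycDist_eq hx hwt ((Nat.mod_lt n hm).trans_le hm')]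
    exact hper.map_mod_nat n
  rw [zetaSum]
  simp_rw [h1]
  rw [Nat.cast_sum, ← add_zero k, add_assoc, zero_add,
    ← sum_range_sub (fun u => (onePos x (k + u) : ℝ))]
  refine sum_congr rfl fun u _ => ?_
  rw [Nat.cast_sub ((onePos_strictMono hx hwt).monotone (by omega))]
  rfl

/-- Sum of the ages, up to half a unit per slot, from the `k`-th one to the `(k + j)`-th one when
these are consecutive deliveries. -/
noncomputable def gapCost (T : ℕ) (x : ℕ → Bool) (k j : ℕ) : ℝ :=
  ((onePos x (k + j) : ℝ) - onePos x k) * framePos T x k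
    + ((onePos x (k + j) : ℝ) - onePos x k) ^ 2 / 2

/-- The quadratic part of the cost has period `w` in `k`, so its average reduces to one period of
length `L`. The frame position is only known to repeat after a superframe, so the linear part keeps
all `w'` terms. -/
theorem sum_gapCost (hT : 0 < T) (hL : 0 < L) (hx : Function.Periodic x L)
    (hwt : 0 < hammingWt L x) (j : ℕ) :
    (∑ k ∈ range (superWt T L x), gapCost T x k j) / superLen T L = bCoeff T L x j := by
  have hle := hammingWt_le_superWt hT hL hx
  have hper := onePos_add_hammingWt hx hwt hx
  have hβ : (superLen T L : ℝ) = L * ((superLen T L / L : ℕ) : ℝ) := by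
    exact_mod_cast superLen_eq T L
  have hβ0 : (superLen T L : ℝ) ≠ 0 := by
    have := superLen_pos hT hL
    positivity
  have hL0 : (L : ℝ) ≠ 0 := by positivity
  have hc0 : ((superLen T L / L : ℕ) : ℝ) ≠ 0 := fun h => hβ0 (by rw [hβ, h, mul_zero])
  simp_rw [bCoeff, F₂, F₃, zetaSum_eq hx hwt (hwt.trans_le hle) le_rfl
    (onePos_add_superWt T hx hwt), zetaSum_eq hx hwt hwt hle hper, gapCost]
  rw [sum_add_distrib, add_div]
  congr 1
  · rw [sum_div]
  · have hf : Function.Periodic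
        (fun k => ((onePos x (k + j) : ℝ) - onePos x k) ^ 2 / 2) (hammingWt L x) := fun k => by
      simp only
      rw [add_right_comm, hper, hper]
      push_cast
      ring
    rw [superWt_eq T hx, sum_range_mul_of_periodic hf, hβ, mul_comm (L : ℝ),
      mul_div_mul_left _ _ hc0, sum_div]
    refine sum_congr rfl fun k _ => ?_
    field_simp

theorem bCoeff_hammingWt (hT : 0 < T) (hL : 0 < L) (hx : Function.Periodic x L)
    (hwt : 0 < hammingWt L x) :
    bCoeff T L x (hammingWt L x)
      = ∑ k ∈ range (superWt T L x), F₂ T L x k (hammingWt L x) + hammingWt L x * F₃ L L := by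
  have hle := hammingWt_le_superWt hT hL hx
  have hper := onePos_add_hammingWt hx hwt hx
  rw [bCoeff]
  simp_rw [zetaSum_eq hx hwt hwt hle hper, hper]
  simp

end Superframe

/-! ### Deliveries and the time average for fixed offsets. -/

section Deliveries

variable {N L T : ℕ} {s : Fin N → ℕ → Bool} {i : Fin N}

/-- An earlier delivery of the same packet would need a second one in its frame. -/
theorem isDrop_iff_succeeds (hT : 0 < T) (hone : AtMostOneOnePerFrame T (s i))
    (τ : Fin N → Fin L) (t : ℕ) : IsDrop T s τ i t ↔ Succeeds s τ i t := by
  refine ⟨fun h => h.1, fun h => ⟨h, fun t' ht' hframe h' => ?_⟩⟩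
  have hmem : ∀ u, localTime τ i u / T = localTime τ i t / T → Transmits s τ i u →
      localTime τ i u % T ∈ {a ∈ range T | s i (localTime τ i t / T * T + a) = true} := by
    intro u hu hx
    rw [mem_filter, mem_range]
    refine ⟨Nat.mod_lt _ hT, ?_⟩
    rw [← hu, Nat.div_add_mod']
    exact hx
  have h1 := card_le_one.1 (hone (localTime τ i t / T)) _ (hmem t' hframe h'.1) _ (hmem t rfl h.1)
  have h2 : localTime τ i t' = localTime τ i t := by
    rw [← Nat.div_add_mod' (localTime τ i t') T, hframe, h1, Nat.div_add_mod']
  simp only [localTime] at h2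
  omega

theorem collisionFree_periodic (hs : IsMHUI N L s) (hwt : 0 < hammingWt L (s i))
    (τ : Fin N → Fin L) : Function.Periodic (CollisionFree s τ i) (hammingWt L (s i)) := by
  intro k
  simp only [CollisionFree, onePos_add_hammingWt (hs.periodic i) hwt (hs.periodic i) k]
  refine propext (forall_congr' fun j => imp_congr_right fun _ => not_congr ?_)
  rw [show onePos (s i) k + L + (L - (τ i : ℕ)) + (τ j : ℕ)
    = onePos (s i) k + (L - (τ i : ℕ)) + (τ j : ℕ) + L by ring, hs.periodic j]

theorem collisionFree_iff_mem_freeSet (hs : IsMHUI N L s) (hwt : 0 < hammingWt L (s i))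
    (τ : Fin N → Fin L) (k : ℕ) :
    CollisionFree s τ i k ↔ k % hammingWt L (s i) ∈ freeSet s i τ := by
  classical
  rw [freeSet, mem_filter, mem_range, (collisionFree_periodic hs hwt τ).map_mod_nat]
  exact ⟨fun h => ⟨Nat.mod_lt _ hwt, h⟩, fun h => h.2⟩

theorem succeeds_iff (hs : IsMHUI N L s) (hwt : 0 < hammingWt L (s i)) (τ : Fin N → Fin L)
    (t : ℕ) : Succeeds s τ i t ↔ ∃ k, CollisionFree s τ i k ∧ t + (τ i : ℕ) = onePos (s i) k := by
  -- `CollisionFree` uses `L - τ i` for `-τ i` to stay in `ℕ`; the extra period `L` changes nothing.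
  have hshift : ∀ j, s j (t + (τ i : ℕ) + (L - (τ i : ℕ)) + (τ j : ℕ)) = s j (t + (τ j : ℕ)) := by
    intro j
    have := (τ i).2
    rw [show t + (τ i : ℕ) + (L - (τ i : ℕ)) + (τ j : ℕ) = t + (τ j : ℕ) + L by omega,
      hs.periodic j]
  constructor
  · rintro ⟨h1, h2⟩
    have h3 : onePos (s i) (Nat.count (fun u => s i u = true) (t + (τ i : ℕ)))
        = t + (τ i : ℕ) := Nat.nth_count h1
    refine ⟨_, fun j hj => ?_, h3.symm⟩
    rw [h3, hshift]
    exact h2 j hj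
  · rintro ⟨k, hk, ht⟩
    refine ⟨?_, fun j hj => ?_⟩
    · change s i (t + (τ i : ℕ)) = true
      rw [ht]
      exact onePos_spec (hs.periodic i) hwt k
    · have := hk j hj
      rw [← ht, hshift] at this
      exact this

/-- Local time of the `m`-th delivery. -/
noncomputable def deliveryTime (s : Fin N → ℕ → Bool) (τ : Fin N → Fin L) (i : Fin N)
    (m : ℕ) : ℕ := onePos (s i) (Nat.nth (CollisionFree s τ i) m)

theorem collisionFree_infinite (hs : IsMHUI N L s) (hwt : 0 < hammingWt L (s i))
    (τ : Fin N → Fin L) : (Set.ofPred (CollisionFree s τ i)).Infinite := by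
  classical
  obtain ⟨k, hk⟩ := freeSet_nonempty hs i τ
  exact infinite_of_periodic hwt (collisionFree_periodic hs hwt τ) ⟨k, (mem_filter.1 hk).2⟩

theorem deliveryTime_strictMono (hs : IsMHUI N L s) (hwt : 0 < hammingWt L (s i))
    (τ : Fin N → Fin L) : StrictMono (deliveryTime s τ i) :=
  (onePos_strictMono (hs.periodic i) hwt).comp
    (Nat.nth_strictMono (collisionFree_infinite hs hwt τ))

theorem succeeds_at_deliveryTime (hs : IsMHUI N L s) (hwt : 0 < hammingWt L (s i))
    (τ : Fin N → Fin L) {t m : ℕ} (ht : t + (τ i : ℕ) = deliveryTime s τ i m) :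
    Succeeds s τ i t :=
  (succeeds_iff hs hwt τ t).2
    ⟨_, Nat.nth_mem_of_infinite (collisionFree_infinite hs hwt τ) m, ht⟩

theorem not_succeeds_between (hs : IsMHUI N L s) (hwt : 0 < hammingWt L (s i))
    (τ : Fin N → Fin L) {t m : ℕ} (h1 : deliveryTime s τ i m < t + (τ i : ℕ))
    (h2 : t + (τ i : ℕ) < deliveryTime s τ i (m + 1)) : ¬ Succeeds s τ i t := by
  intro h
  obtain ⟨k, hk, ht⟩ := (succeeds_iff hs hwt τ t).1 h
  rw [ht] at h1 h2
  have hmono := onePos_strictMono (hs.periodic i) hwt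
  have h3 := hmono.lt_iff_lt.1 h1
  have h4 := Nat.le_nth_of_lt_nth_succ (hmono.lt_iff_lt.1 h2) hk
  omega

theorem instAoI_of_drop {τ : Fin N → Fin L} {a₀ t : ℕ} (h : IsDrop T s τ i t) :
    instAoI T s τ i a₀ t = (t + (τ i : ℕ)) % T := by
  cases t with
  | zero => rw [instAoI, if_pos h]; rfl
  | succ t => rw [instAoI, if_pos h]; rfl

theorem instAoI_after_delivery (hs : IsMHUI N L s) (hwt : 0 < hammingWt L (s i)) (hT : 0 < T)
    (hone : AtMostOneOnePerFrame T (s i)) (τ : Fin N → Fin L) (a₀ : ℕ) {m n : ℕ}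
    (hm : (τ i : ℕ) ≤ deliveryTime s τ i m)
    (hn : deliveryTime s τ i m + n < deliveryTime s τ i (m + 1)) :
    instAoI T s τ i a₀ (deliveryTime s τ i m - (τ i : ℕ) + n) = deliveryTime s τ i m % T + n := by
  induction n with
  | zero =>
    rw [add_zero, add_zero, instAoI_of_drop, Nat.sub_add_cancel hm]
    rw [isDrop_iff_succeeds hT hone]
    exact succeeds_at_deliveryTime hs hwt τ (Nat.sub_add_cancel hm)
  | succ n ih =>
    rw [← add_assoc, instAoI, if_neg, ih (by omega), add_assoc]
    rw [isDrop_iff_succeeds hT hone]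
    exact not_succeeds_between (m := m) hs hwt τ (by omega) (by omega)

/-- A gap of `g` slots costs `gapCost` minus `g / 2`, and the halves telescope. -/
theorem sum_instAoI_between (hs : IsMHUI N L s) (hwt : 0 < hammingWt L (s i)) (hT : 0 < T)
    (hone : AtMostOneOnePerFrame T (s i)) (τ : Fin N → Fin L) (a₀ : ℕ) {m : ℕ}
    (hm : (τ i : ℕ) ≤ deliveryTime s τ i m) (q : ℕ) :
    ∑ t ∈ Ico (deliveryTime s τ i m - (τ i : ℕ)) (deliveryTime s τ i (m + q) - (τ i : ℕ)),
        (instAoI T s τ i a₀ t : ℝ)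
      = ∑ v ∈ range q, gapCost T (s i) (Nat.nth (CollisionFree s τ i) (m + v))
          (Nat.nth (CollisionFree s τ i) (m + v + 1) - Nat.nth (CollisionFree s τ i) (m + v))
        - ((deliveryTime s τ i (m + q) : ℝ) - deliveryTime s τ i m) / 2 := by
  have hmono := deliveryTime_strictMono hs hwt τ
  induction q with
  | zero => simp
  | succ q ih =>
    have h1 : deliveryTime s τ i m ≤ deliveryTime s τ i (m + q) := hmono.monotone (by omega)
    have h2 : deliveryTime s τ i (m + q) < deliveryTime s τ i (m + q + 1) := hmono (by omega)
    rw [← add_assoc, ← sum_Ico_consecutive (n := deliveryTime s τ i (m + q) - (τ i : ℕ)) _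
      (by omega) (by omega), ih, sum_range_succ, sum_Ico_eq_sum_range]
    set g := deliveryTime s τ i (m + q + 1) - deliveryTime s τ i (m + q) with hg
    have hgr : (g : ℝ) = (deliveryTime s τ i (m + q + 1) : ℝ) - deliveryTime s τ i (m + q) :=
      Nat.cast_sub h2.le
    have h3 : deliveryTime s τ i (m + q + 1) - (τ i : ℕ)
        - (deliveryTime s τ i (m + q) - (τ i : ℕ)) = g := by omega
    have h4 : ∀ n ∈ range g, (instAoI T s τ i a₀
        (deliveryTime s τ i (m + q) - (τ i : ℕ) + n) : ℝ)
        = ((deliveryTime s τ i (m + q) % T : ℕ) : ℝ) + n := by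
      intro n hn
      rw [mem_range] at hn
      rw [instAoI_after_delivery hs hwt hT hone τ a₀ (by omega) (by omega), Nat.cast_add]
    have hgauss : ∀ g : ℕ, ∑ n ∈ range g, (n : ℝ) = (g : ℝ) ^ 2 / 2 - g / 2 := by
      intro g
      induction g with
      | zero => simp
      | succ g ih => rw [sum_range_succ, ih]; push_cast; ring
    rw [h3, sum_congr rfl h4, sum_add_distrib, sum_const, card_range, nsmul_eq_mul, hgauss]
    have h5 : Nat.nth (CollisionFree s τ i) (m + q) ≤ Nat.nth (CollisionFree s τ i) (m + q + 1) :=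
      Nat.nth_monotone (collisionFree_infinite hs hwt τ) (by omega)
    rw [gapCost, Nat.add_sub_cancel' h5]
    change _ = _ + (((deliveryTime s τ i (m + q + 1) : ℝ) - deliveryTime s τ i (m + q))
        * ((deliveryTime s τ i (m + q) % T : ℕ) : ℝ)
      + ((deliveryTime s τ i (m + q + 1) : ℝ) - deliveryTime s τ i (m + q)) ^ 2 / 2) - _
    rw [← hgr]
    linarith

-- From the `q`-th delivery on the ages have period `β`, and the initial age is forgotten; the limit
-- is the mean over the window from delivery `q` to delivery `2 q`.
open Classical in
theorem tendsto_average_instAoI (hs : IsMHUI N L s) (hwt : 0 < hammingWt L (s i)) (hT : 0 < T)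
    (hL : 0 < L) (hone : AtMostOneOnePerFrame T (s i)) (τ : Fin N → Fin L) (a₀ : ℕ) :
    Tendsto
      (fun n : ℕ => (1 / (n : ℝ)) * ∑ t ∈ range (n + 1), (instAoI T s τ i a₀ t : ℝ)) atTop
      (𝓝 ((∑ k ∈ range (superWt T L (s i)), ∑ j ∈ Icc 1 (hammingWt L (s i)),
        if Consecutive (CollisionFree s τ i) k j then gapCost T (s i) k j else 0)
          / superLen T L - 1 / 2)) := by
  have hmono := deliveryTime_strictMono hs hwt τ
  have hinf := collisionFree_infinite hs hwt τ
  have hper := collisionFree_periodic hs hwt τ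
  have hβ := superLen_pos hT hL
  have hLβ : L ≤ superLen T L := Nat.le_of_dvd hβ (Nat.dvd_lcm_right T L)
  have hTβ : T ∣ superLen T L := Nat.dvd_lcm_left T L
  have hposβ := onePos_add_superWt T (hs.periodic i) hwt
  have hper' : Function.Periodic (CollisionFree s τ i) (superWt T L (s i)) := by
    rw [superWt_eq T (hs.periodic i), mul_comm]
    exact hper.nat_mul _
  set q := Nat.count (CollisionFree s τ i) (superWt T L (s i)) with hq
  have hnth : ∀ m, Nat.nth (CollisionFree s τ i) (m + q)
      = Nat.nth (CollisionFree s τ i) m + superWt T L (s i) :=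
    nth_add_count_of_periodic hper' hinf
  have hdel : ∀ m, deliveryTime s τ i (m + q) = deliveryTime s τ i m + superLen T L := fun m => by
    rw [deliveryTime, hnth, hposβ, deliveryTime]
  have hτ := (τ i).2
  -- Delivery `0` may precede slot `0`, but delivery `q` is at local time at least `β ≥ L > τ i`.
  have hstart : (τ i : ℕ) ≤ deliveryTime s τ i q := by
    have := hdel 0
    rw [zero_add] at this
    omega
  have hperiodic : ∀ t, deliveryTime s τ i q - (τ i : ℕ) ≤ t →
      (instAoI T s τ i a₀ (t + superLen T L) : ℝ) = instAoI T s τ i a₀ t := by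
    intro t ht
    have hex : ∃ m, t + (τ i : ℕ) < deliveryTime s τ i (m + 1) :=
      ⟨t + (τ i : ℕ), hmono.le_apply⟩
    classical
    -- `m` is the last delivery not later than slot `t`.
    set m := Nat.find hex with hm
    have hlt : t + (τ i : ℕ) < deliveryTime s τ i (m + 1) := Nat.find_spec hex
    have hqm : q < m + 1 := hmono.lt_iff_lt.1 (by omega)
    have hle : deliveryTime s τ i m ≤ t + (τ i : ℕ) := by
      rcases Nat.eq_zero_or_pos m with h0 | hpos
      · rw [h0, ← (by omega : q = 0)]
        omega
      · have := Nat.find_min hex (m := m - 1) (by omega)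
        rw [Nat.sub_add_cancel hpos] at this
        omega
    have hqle : deliveryTime s τ i q ≤ deliveryTime s τ i m := hmono.monotone (by omega)
    obtain ⟨n, hn⟩ := Nat.exists_eq_add_of_le hle
    have e1 : t = deliveryTime s τ i m - (τ i : ℕ) + n := by omega
    have h1 := hdel m
    have h2 := hdel (m + 1)
    rw [add_right_comm] at h2
    have e2 : t + superLen T L = deliveryTime s τ i (m + q) - (τ i : ℕ) + n := by omega
    have h3 := instAoI_after_delivery hs hwt hT hone τ a₀ (m := m) (n := n) (by omega) (by omega)
    have h4 := instAoI_after_delivery hs hwt hT hone τ a₀ (m := m + q) (n := n) (by omega)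
      (by omega)
    have h5 : deliveryTime s τ i (m + q) % T = deliveryTime s τ i m % T := by
      obtain ⟨c, hc⟩ := hTβ
      rw [h1, hc, Nat.add_mul_mod_self_left]
    rw [e2, h4, h5, ← h3, ← e1]
  have hlim := tendsto_average_of_eventually_periodic
    (a := fun t => (instAoI T s τ i a₀ t : ℝ)) hβ hperiodic
  convert hlim using 2
  have hend : deliveryTime s τ i q - (τ i : ℕ) + superLen T L
      = deliveryTime s τ i (q + q) - (τ i : ℕ) := by
    rw [hdel]
    omega
  rw [hend, sum_instAoI_between hs hwt hT hone τ a₀ hstart, hdel,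
    ← sum_consecutive_nth hwt hper hinf (gapCost T (s i))]
  -- Costs and deliveries repeat after a superframe, so the window may be counted from delivery `0`.
  have hcost : ∀ k j, gapCost T (s i) (k + superWt T L (s i)) j = gapCost T (s i) k j := by
    intro k j
    have hf : framePos T (s i) (k + superWt T L (s i)) = framePos T (s i) k := by
      obtain ⟨c, hc⟩ := hTβ
      rw [framePos, hposβ, hc, Nat.add_mul_mod_self_left, framePos]
    rw [gapCost, gapCost, hf, add_right_comm, hposβ, hposβ]
    push_cast
    ring
  have hterm : ∀ v, gapCost T (s i) (Nat.nth (CollisionFree s τ i) (q + v))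
      (Nat.nth (CollisionFree s τ i) (q + v + 1) - Nat.nth (CollisionFree s τ i) (q + v))
      = gapCost T (s i) (Nat.nth (CollisionFree s τ i) v)
        (Nat.nth (CollisionFree s τ i) (v + 1) - Nat.nth (CollisionFree s τ i) v) := by
    intro v
    rw [add_assoc, add_comm q v, add_comm q (v + 1), hnth, hnth, hcost, Nat.add_sub_add_right]
  simp_rw [hterm]
  have hβ0 : (superLen T L : ℝ) ≠ 0 := by positivity
  push_cast
  field_simp
  ring

end Deliveries

/-! ### Averaging over the offsets. -/

open Classical in
theorem sum_offsets_consecutive {N L w : ℕ} {s : Fin N → ℕ → Bool} (hs : IsMHUI N L s)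
    (hw : ∀ j, hammingWt L (s j) = w) (hw0 : 0 < w) (hL : 0 < L) (i : Fin N) (k j : ℕ)
    (hj : j ∈ Icc 1 w) :
    (∑ τ : Fin N → Fin L, if Consecutive (CollisionFree s τ i) k j then (1 : ℝ) else 0)
      = (L : ℝ) ^ N * (eventProb N L w 1 * (if j = w then 1 else 0)
        + ∑ r ∈ Icc 2 w, eventProb N L w r *
            (if j < w then ((w - j - 1).choose (r - 2) : ℝ) else 0)) := by
  have hwt : 0 < hammingWt L (s i) := by rw [hw]; exact hw0
  have hmem : ∀ τ, CollisionFree (L := L) s τ i = fun n => n % w ∈ freeSet s i τ := fun τ => by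
    funext n
    rw [collisionFree_iff_mem_freeSet hs hwt, hw]
  have hmaps : ∀ τ ∈ (univ : Finset (Fin N → Fin L)), freeSet s i τ ∈ (range w).powerset := by
    intro τ _
    rw [mem_powerset, ← hw i]
    exact filter_subset _ _
  rw [← sum_consecutive_card hw0 (eventProb N L w) k j hj, mul_sum]
  simp_rw [hmem]
  rw [← sum_fiberwise_of_maps_to hmaps]
  refine sum_congr rfl fun S hS => ?_
  rw [sum_congr rfl (g := fun _ => if Consecutive (fun n => n % w ∈ S) k j then (1 : ℝ) else 0)
    (fun τ hτ => by rw [(mem_filter.1 hτ).2]), sum_const, nsmul_eq_mul,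
    card_freeSet_eq hs hw hL i (mem_powerset.1 hS)]
  split_ifs <;> simp

/-- For `j > w - r + 1` fewer than `r - 2` places remain off the arc, which truncates the range. -/
theorem sum_choose_mul_eq {w r : ℕ} (hr : r ∈ Icc 2 w) (b : ℕ → ℝ) :
    ∑ j ∈ Icc 1 w, b j * (if j < w then ((w - j - 1).choose (r - 2) : ℝ) else 0)
      = ∑ j ∈ Icc 1 (w - r + 1), ((w - j - 1).factorial : ℝ) * b j /
          (((r - 2).factorial : ℝ) * ((w - j - (r - 1)).factorial : ℝ)) := by
  rw [mem_Icc] at hr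
  have hsub : Icc 1 (w - r + 1) ⊆ Icc 1 w := Icc_subset_Icc_right (by omega)
  rw [← sum_subset hsub]
  · refine sum_congr rfl fun j hj => ?_
    rw [mem_Icc] at hj
    rw [if_pos (by omega), Nat.cast_choose ℝ (by omega : r - 2 ≤ w - j - 1),
      (by omega : w - j - 1 - (r - 2) = w - j - (r - 1))]
    ring
  · intro j hj hj'
    rw [mem_Icc] at hj hj'
    split_ifs with h
    · rw [Nat.choose_eq_zero_of_lt (by omega), Nat.cast_zero, mul_zero]
    · rw [mul_zero]

theorem theorem4 (N L T w : ℕ) (s : Fin N → ℕ → Bool) (i : Fin N)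
    (hT : 0 < T) (hTL : T < L)
    (hs : IsMHUI N L s) (hw : ∀ j, hammingWt L (s j) = w)
    (hone : AtMostOneOnePerFrame T (s i)) :
    ∃ A : (Fin N → Fin L) → ℝ,
      (∀ (τ : Fin N → Fin L) (a₀ : ℕ),
        Tendsto
          (fun n : ℕ => (1 / (n : ℝ)) * ∑ t ∈ range (n + 1), (instAoI T s τ i a₀ t : ℝ))
          atTop (𝓝 (A τ))) ∧
      (1 / (L : ℝ) ^ N) * ∑ τ : Fin N → Fin L, A τ =
        eventProb N L w 1 *
            (∑ k ∈ range (superWt T L (s i)), F₂ T L (s i) k w + (w : ℝ) * F₃ L (L : ℝ))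
          + ∑ r ∈ Icc 2 w, eventProb N L w r *
              ∑ j ∈ Icc 1 (w - r + 1),
                ((w - j - 1).factorial : ℝ) * bCoeff T L (s i) j /
                  (((r - 2).factorial : ℝ) * ((w - j - (r - 1)).factorial : ℝ))
          - 1 / 2 := by
  classical
  have hL : 0 < L := by omega
  have hw0 : 0 < w := by
    have := i.pos
    have := hs.le_weight i
    rw [hw] at this
    omega
  have hwt : 0 < hammingWt L (s i) := by rw [hw]; exact hw0
  refine ⟨_, fun τ a₀ => tendsto_average_instAoI hs hwt hT hL hone τ a₀, ?_⟩
  have hLN : (L : ℝ) ^ N ≠ 0 := by positivity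
  have hβ : (superLen T L : ℝ) ≠ 0 := by
    have := superLen_pos hT hL
    positivity
  have hbw := bCoeff_hammingWt hT hL (hs.periodic i) hwt
  rw [hw] at hbw
  -- For `j ∈ Icc 1 w`, `Q j` is the proportion of offset vectors for which `k` and `k + j` are
  -- consecutive free indices, the same for all `k`.
  set Q : ℕ → ℝ := fun j => eventProb N L w 1 * (if j = w then 1 else 0)
    + ∑ r ∈ Icc 2 w, eventProb N L w r *
        (if j < w then ((w - j - 1).choose (r - 2) : ℝ) else 0) with hQ
  have hsum : (∑ τ : Fin N → Fin L, ∑ k ∈ range (superWt T L (s i)), ∑ j ∈ Icc 1 w,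
      if Consecutive (CollisionFree s τ i) k j then gapCost T (s i) k j else 0)
      = (L : ℝ) ^ N * (superLen T L * ∑ j ∈ Icc 1 w, bCoeff T L (s i) j * Q j) := by
    rw [sum_comm]
    have h1 : ∀ k, (∑ τ : Fin N → Fin L, ∑ j ∈ Icc 1 w,
        if Consecutive (CollisionFree s τ i) k j then gapCost T (s i) k j else 0)
        = ∑ j ∈ Icc 1 w, gapCost T (s i) k j * ((L : ℝ) ^ N * Q j) := by
      intro k
      rw [sum_comm]
      refine sum_congr rfl fun j hj => ?_
      rw [← sum_offsets_consecutive hs hw hw0 hL i k j hj, mul_sum]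
      refine sum_congr rfl fun τ _ => ?_
      split_ifs <;> simp
    simp_rw [h1]
    rw [sum_comm, mul_sum, mul_sum]
    refine sum_congr rfl fun j _ => ?_
    rw [← sum_mul, ← sum_gapCost hT hL (hs.periodic i) hwt j]
    field_simp
  have hcard : ∑ _τ : Fin N → Fin L, (1 / 2 : ℝ) = (L : ℝ) ^ N * (1 / 2) := by
    rw [sum_const, card_univ, Fintype.card_fun, Fintype.card_fin, Fintype.card_fin, nsmul_eq_mul,
      Nat.cast_pow]
  rw [hw, sum_sub_distrib, ← sum_div, hsum, hcard]
  have hfinal : ∑ j ∈ Icc 1 w, bCoeff T L (s i) j * Q j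
      = eventProb N L w 1 * bCoeff T L (s i) w
        + ∑ r ∈ Icc 2 w, eventProb N L w r *
            ∑ j ∈ Icc 1 w, bCoeff T L (s i) j *
              (if j < w then ((w - j - 1).choose (r - 2) : ℝ) else 0) := by
    simp_rw [hQ, mul_add, sum_add_distrib]
    congr 1
    · rw [sum_eq_single w]
      · rw [if_pos rfl]
        ring
      · intro j _ hj
        rw [if_neg hj, mul_zero, mul_zero]
      · intro h
        exact absurd (mem_Icc.2 ⟨hw0, le_rfl⟩) h
    · simp_rw [mul_sum]
      rw [sum_comm]
      refine sum_congr rfl fun r _ => sum_congr rfl fun j _ => ?_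
      ring
  rw [sum_congr rfl fun r hr => congrArg (eventProb N L w r * ·)
    (sum_choose_mul_eq hr (bCoeff T L (s i)))] at hfinal
  rw [← hbw, ← hfinal]
  field_simp
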